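/- Let $(\mathcal X,\mathcal A)$ be a measurable space, $\mathcal P_0$ a set of probability measures on it, $P_1$ a probability measure, and $\mu$ a measure dominating $P_1$ and every $P\in\mathcal P_0$. An e-variable for $\mathcal P_0$ is a measurable $B:\mathcal X\to[0,\infty]$ with $\mathbb E_P[B]\le 1$ for all $P\in\mathcal P_0$. A numeraire is an e-variable $B^*$ that is $P_1$-a.s. strictly positive and satisfies $\mathbb E_{P_1}[B/B^*]\le 1$ for every e-variable $B$. Let $B^*$ be a numeraire, let $P_0$ be the reverse information projection, $dP_0/dP_1=1/B^*$, let $p_0,p_1$ be densities of $P_0,P_1$ with respect to $\mu$, and let $k=\int p_0\,d\mu$. Put $0/0:=0$ throughout. For small $\epsilon>0$ let $c'=c'_\epsilon$ and $c''=c''_\epsilon$ in $[0,\infty]$ be determined by $$(1-\epsilon)\Big\{P_0\big[\tfrac{p_1}{p_0}<c''\big]+\tfrac1{c''}P_1\big[\tfrac{p_1}{p_0}\ge c''\big]\Big\}=k,\qquad (1-\epsilon)\Big\{P_1\big[\tfrac{p_1}{p_0}>c'\big]+c'P_0\big[\tfrac{p_1}{p_0}\le c'\big]\Big\}=1,$$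 and let $q_{0,\epsilon}=(1-\epsilon)p_0$ where $p_1/p_0<c''$ and $q_{0,\epsilon}=(1-\epsilon)p_1/c''$ elsewhere; $q_{1,\epsilon}=(1-\epsilon)p_1$ where $p_1/p_0>c'$ and $q_{1,\epsilon}=c'(1-\epsilon)p_0$ elsewhere. Define $$B_\epsilon(x)=\frac{q_{1,\epsilon}(x)/q_{0,\epsilon}(x)}{\sup_{P\in\mathcal P_0}\mathbb E_{X\sim P}\big[q_{1,\epsilon}(X)/q_{0,\epsilon}(X)\big]+(c''-c')^+\epsilon},\qquad R_{0,\epsilon}=1,\quad R_{n,\epsilon}=R_{n-1,\epsilon}\,B_\epsilon(X_n)$$ (the positive part is superfluous whenever $c'\le c''$). Assume that $\mathcal P_0$ is convex and closed (in total variation, among probability measures), and that $\inf_{P\in\mathcal P_0}D_{\mathrm{KL}}(P_1,P)<\infty$. Then $p_1/p_0$ is a version of the numeraire: it is itself a numeraire, and $p_1/p_0=B^*$ $P_1$-a.s. Moreover, as $\epsilon\downarrow0$, $B_\epsilon(x)\to p_1(x)/p_0(x)$ for $\mu$-a.e. $x$. Hence, for every sequence of random variables $X_1,X_2,\dots$ whose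 individual laws are absolutely continuous with respect to $\mu$ and every fixed $n\in\mathbb N$, almost surely $$R_{n,\epsilon}\to\prod_{i=1}^n \frac{p_1(X_i)}{p_0(X_i)}\qquad\text{as }\epsilon\downarrow0 .$$ -/

import Mathlib

open MeasureTheory Filter Topology
open scoped ENNReal NNReal

noncomputable section

namespace RobustNumeraire

variable {𝓧 : Type*} [MeasurableSpace 𝓧]

/-- Total variation distance `sup_A |P A - Q A|` of two probability measures. -/
def tvDist (P Q : Measure 𝓧) : ℝ :=
  ⨆ A : {A : Set 𝓧 // MeasurableSet A}, |P.real A - Q.real A|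

/-- A set of probability measures is closed in total variation, within the probability measures.
(Total variation is the finest of the usual topologies on probability measures, so closedness in
the weak or the setwise topology implies this.) -/
def IsTVClosed (H₀ : Set (Measure 𝓧)) : Prop :=
  ∀ (u : ℕ → Measure 𝓧) (P : Measure 𝓧), (∀ n, u n ∈ H₀) → IsProbabilityMeasure P →
    Tendsto (fun n => tvDist (u n) P) atTop (𝓝 0) → P ∈ H₀

/-- E-variables for the null `H₀`: nonnegative, with expectation at most one under every member. -/
def IsEVariable (H₀ : Set (Measure 𝓧)) (B : 𝓧 → ℝ≥0∞) : Prop :=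
  Measurable B ∧ ∀ P ∈ H₀, ∫⁻ x, B x ∂P ≤ 1

/-- `Bs` is a numeraire for the null `H₀` against the alternative `P₁`. -/
structure IsNumeraire (H₀ : Set (Measure 𝓧)) (P₁ : Measure 𝓧) (Bs : 𝓧 → ℝ≥0∞) : Prop where
  isEVariable : IsEVariable H₀ Bs
  pos : ∀ᵐ x ∂P₁, 0 < Bs x
  numeraire : ∀ B : 𝓧 → ℝ≥0∞, IsEVariable H₀ B → ∫⁻ x, B x / Bs x ∂P₁ ≤ 1

/-- The reverse information projection: the measure `P₀` with `dP₀/dP₁ = 1 / Bs`. -/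
def ripr (P₁ : Measure 𝓧) (Bs : 𝓧 → ℝ≥0∞) : Measure 𝓧 :=
  P₁.withDensity fun x => (Bs x)⁻¹

/-- The equations for the truncation levels `c'`, `c''` at contamination level `ε`, where `p₀`, `p₁`
are densities of the sub-probability measure `P₀` and of the probability measure `P₁`; they say that
`q₀` below has the same total mass as `P₀` and that `q₁` below has total mass one. -/
structure IsTruncation (P₀ P₁ : Measure 𝓧) (p₀ p₁ : 𝓧 → ℝ≥0∞) (ε : ℝ) (c' c'' : ℝ≥0∞) :
    Prop where
  upper : ENNReal.ofReal (1 - ε) *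
    (P₀ {x | p₁ x / p₀ x < c''} + c''⁻¹ * P₁ {x | c'' ≤ p₁ x / p₀ x}) = P₀ Set.univ
  lower : ENNReal.ofReal (1 - ε) *
    (P₁ {x | c' < p₁ x / p₀ x} + c' * P₀ {x | p₁ x / p₀ x ≤ c'}) = 1

open Classical in
/-- Huber's density `q_{0,ε}`. -/
def q₀ (p₀ p₁ : 𝓧 → ℝ≥0∞) (ε : ℝ) (c'' : ℝ≥0∞) (x : 𝓧) : ℝ≥0∞ :=
  if p₁ x / p₀ x < c'' then ENNReal.ofReal (1 - ε) * p₀ x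
  else c''⁻¹ * ENNReal.ofReal (1 - ε) * p₁ x

open Classical in
/-- Huber's density `q_{1,ε}`. -/
def q₁ (p₀ p₁ : 𝓧 → ℝ≥0∞) (ε : ℝ) (c' : ℝ≥0∞) (x : 𝓧) : ℝ≥0∞ :=
  if c' < p₁ x / p₀ x then ENNReal.ofReal (1 - ε) * p₁ x
  else c' * ENNReal.ofReal (1 - ε) * p₀ x

/-- The truncated likelihood ratio `q_{1,ε} / q_{0,ε}`; its value is `0 / 0 = 0` where both `p₀` and
`p₁` vanish. -/
def truncRatio (p₀ p₁ : 𝓧 → ℝ≥0∞) (ε : ℝ) (c' c'' : ℝ≥0∞) (x : 𝓧) : ℝ≥0∞ :=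
  q₁ p₀ p₁ ε c' x / q₀ p₀ p₁ ε c'' x

/-- The robust e-variable `B_ε`. -/
def robustB (H₀ : Set (Measure 𝓧)) (p₀ p₁ : 𝓧 → ℝ≥0∞) (ε : ℝ) (c' c'' : ℝ≥0∞) (x : 𝓧) : ℝ≥0∞ :=
  truncRatio p₀ p₁ ε c' c'' x /
    ((⨆ P ∈ H₀, ∫⁻ y, truncRatio p₀ p₁ ε c' c'' y ∂P) + (c'' - c') * ENNReal.ofReal ε)

/-- The process `R_0 = 1`, `R_n = R_{n-1} * B (X_n)` along the data `X_1, X_2, …`. -/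
def process (B : 𝓧 → ℝ≥0∞) (X : ℕ → 𝓧) : ℕ → ℝ≥0∞
  | 0 => 1
  | n + 1 => process B X n * B (X (n + 1))

end RobustNumeraire

end

/-! Write `Z = p₁ / p₀`. Both Huber densities are maxima, `q₀ = (1 - ε) max(p₀, p₁/c'')` and `q₁ =
(1 - ε) max(p₁, c' p₀)`, so `min(Z, c'') ≤ q₁/q₀ ≤ max(Z, c')` wherever `p₀` and `p₁` are positive
and finite. Since `dP₁ = Z dP₀`, the truncation equations read `(1 - ε) ∫ max(Z, c') dP₀ = 1` and
`(1 - ε) ∫ max(1, Z/c'') dP₀ = P₀(𝓧)`. As `1 - ε → 1`, they push `c''` above every level below `ess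
sup Z` and `c'` below every level above `ess inf Z` (`eventually_lt_upper`, `eventually_lower_lt`).
Truncation then disappears pointwise, and `q₁/q₀ → Z`. The denominator tends to one
(`tendsto_robustB_denominator`): `sup_P E_P[Z] = 1`, as otherwise `Z` could be scaled up, and `c'' ε
→ 0` (`tendsto_upper_mul`). -/

namespace RobustNumeraire

/-! ### Pointwise bounds on the truncated ratio. -/

section TruncRatio

variable {𝓧 : Type*} {p₀ p₁ : 𝓧 → ℝ≥0∞} {ε : ℝ} {c' c'' : ℝ≥0∞} {x : 𝓧}

theorem truncRatio_eq_zero (h₀ : p₀ x = 0) (h₁ : p₁ x = 0) : truncRatio p₀ p₁ ε c' c'' x = 0 := by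
  simp [truncRatio, q₁, h₀, h₁]

/-- Truncation only raises `q₀` above `(1 - ε) p₀`. No ordering of `c'` and `c''` is needed. -/
theorem truncRatio_le_max (h₀ : p₀ x ≠ 0) (h₀' : p₀ x ≠ ∞) (hc0 : c'' ≠ 0) (hc : c'' ≠ ∞) :
    truncRatio p₀ p₁ ε c' c'' x ≤ max (p₁ x / p₀ x) c' := by
  set a := ENNReal.ofReal (1 - ε) with ha
  have hp : p₁ x = p₁ x / p₀ x * p₀ x := (ENNReal.div_mul_cancel h₀ h₀').symm
  have hq₀ : a * p₀ x ≤ q₀ p₀ p₁ ε c'' x := by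
    unfold q₀
    split_ifs with hlt
    · exact le_rfl
    · calc a * p₀ x = c''⁻¹ * a * (c'' * p₀ x) := by
            rw [mul_mul_mul_comm, ENNReal.inv_mul_cancel hc0 hc, one_mul]
        _ ≤ c''⁻¹ * a * (p₁ x / p₀ x * p₀ x) := by gcongr; exact not_lt.1 hlt
        _ = _ := by rw [← hp]
  refine ENNReal.div_le_of_le_mul (le_trans ?_ (mul_le_mul_right hq₀ _))
  unfold q₁
  split_ifs with hlt
  · calc a * p₁ x = p₁ x / p₀ x * (a * p₀ x) := by nth_rw 1 [hp]; ring
      _ ≤ _ := by gcongr; exact le_max_left _ _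
  · calc c' * a * p₀ x = c' * (a * p₀ x) := by ring
      _ ≤ _ := by gcongr; exact le_max_right _ _

theorem min_le_truncRatio (h₀ : p₀ x ≠ 0) (h₀' : p₀ x ≠ ∞) (h₁ : p₁ x ≠ 0) (h₁' : p₁ x ≠ ∞)
    (hc0 : c'' ≠ 0) (hc : c'' ≠ ∞) (hε : ε < 1) :
    min (p₁ x / p₀ x) c'' ≤ truncRatio p₀ p₁ ε c' c'' x := by
  set a := ENNReal.ofReal (1 - ε) with ha
  have ha0 : a ≠ 0 := by simp [ha, hε]
  have ha' : a ≠ ∞ := ENNReal.ofReal_ne_top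
  have hp : p₁ x = p₁ x / p₀ x * p₀ x := (ENNReal.div_mul_cancel h₀ h₀').symm
  have hq₁ : a * p₁ x ≤ q₁ p₀ p₁ ε c' x := by
    unfold q₁
    split_ifs with hlt
    · exact le_rfl
    · calc a * p₁ x = p₁ x / p₀ x * a * p₀ x := by nth_rw 1 [hp]; ring
        _ ≤ _ := by gcongr; exact not_lt.1 hlt
  have hq₀0 : q₀ p₀ p₁ ε c'' x ≠ 0 := by
    unfold q₀; split_ifs <;> simp [← ha, ha0, h₀, h₁, hc]
  have hq₀' : q₀ p₀ p₁ ε c'' x ≠ ∞ := by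
    unfold q₀
    split_ifs
    · exact ENNReal.mul_ne_top ha' h₀'
    · exact ENNReal.mul_ne_top (ENNReal.mul_ne_top (by simpa using hc0) ha') h₁'
  rw [truncRatio, ENNReal.le_div_iff_mul_le (Or.inl hq₀0) (Or.inl hq₀')]
  refine le_trans ?_ hq₁
  unfold q₀
  split_ifs with hlt
  · calc _ ≤ p₁ x / p₀ x * (a * p₀ x) := by gcongr; exact min_le_left _ _
      _ = a * (p₁ x / p₀ x * p₀ x) := by ring
      _ = _ := by rw [← hp]
  · calc _ ≤ c'' * (c''⁻¹ * a * p₁ x) := by gcongr; exact min_le_right _ _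
      _ = c'' * c''⁻¹ * (a * p₁ x) := by ring
      _ = _ := by rw [ENNReal.mul_inv_cancel hc0 hc, one_mul]

end TruncRatio

theorem tendsto_process {𝓧 : Type*} {B : ℝ → 𝓧 → ℝ≥0∞} {Z : 𝓧 → ℝ≥0∞} {X : ℕ → 𝓧} {l : Filter ℝ}
    (hB : ∀ i, Tendsto (fun ε => B ε (X i)) l (𝓝 (Z (X i)))) (hZ : ∀ i, Z (X i) ≠ ∞) (n : ℕ) :
    Tendsto (fun ε => process (B ε) X n) l (𝓝 (∏ i ∈ Finset.Icc 1 n, Z (X i))) := by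
  induction n with
  | zero => simpa [process] using tendsto_const_nhds
  | succ n ih =>
    rw [Finset.prod_Icc_succ_top (by omega)]
    exact ENNReal.Tendsto.mul ih (Or.inr (hZ _)) (hB _)
      (Or.inr (ENNReal.prod_ne_top fun i _ => hZ i))

variable {𝓧 : Type*} [MeasurableSpace 𝓧]

/-! ### The truncation equations as integrals, and nondegenerate levels. -/

section Truncation

variable {P₀ P₁ : Measure 𝓧} {p₀ p₁ : 𝓧 → ℝ≥0∞} {ε : ℝ} {c' c'' : ℝ≥0∞}

theorem IsTruncation.lintegral_max_lower (h : IsTruncation P₀ P₁ p₀ p₁ ε c' c'')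
    (hZ : Measurable fun x => p₁ x / p₀ x) (hP : P₁ = P₀.withDensity fun x => p₁ x / p₀ x) :
    ENNReal.ofReal (1 - ε) * ∫⁻ x, max (p₁ x / p₀ x) c' ∂P₀ = 1 := by
  rw [← h.lower]
  have hs : MeasurableSet {x | c' < p₁ x / p₀ x} := measurableSet_lt measurable_const hZ
  have hc : {x | c' < p₁ x / p₀ x}ᶜ = {x | p₁ x / p₀ x ≤ c'} := by ext x; simp
  congr 1
  rw [← lintegral_add_compl _ hs, hP, withDensity_apply _ hs]
  congr 1
  · exact setLIntegral_congr_fun hs fun x hx => max_eq_left (le_of_lt hx)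
  · rw [← hc, ← setLIntegral_const]
    refine setLIntegral_congr_fun hs.compl fun x hx => max_eq_right ?_
    simpa using hx

theorem IsTruncation.lintegral_max_upper (h : IsTruncation P₀ P₁ p₀ p₁ ε c' c'')
    (hZ : Measurable fun x => p₁ x / p₀ x) (hP : P₁ = P₀.withDensity fun x => p₁ x / p₀ x)
    (h0 : c'' ≠ 0) (htop : c'' ≠ ∞) :
    ENNReal.ofReal (1 - ε) * ∫⁻ x, max 1 (c''⁻¹ * (p₁ x / p₀ x)) ∂P₀ = P₀ Set.univ := by
  rw [← h.upper]
  have hs : MeasurableSet {x | p₁ x / p₀ x < c''} := measurableSet_lt hZ measurable_const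
  have hc : {x | p₁ x / p₀ x < c''}ᶜ = {x | c'' ≤ p₁ x / p₀ x} := by ext x; simp
  congr 1
  rw [← lintegral_add_compl _ hs, hP, ← hc, withDensity_apply _ hs.compl,
    ← lintegral_const_mul _ hZ]
  congr 1
  · rw [← one_mul (P₀ _), ← setLIntegral_const]
    refine setLIntegral_congr_fun hs fun x hx => max_eq_left ?_
    rw [mul_comm, ← div_eq_mul_inv]
    exact ENNReal.div_le_of_le_mul (by simpa using le_of_lt hx)
  · refine setLIntegral_congr_fun hs.compl fun x hx => max_eq_right ?_
    have hx' : c'' ≤ p₁ x / p₀ x := by simpa using hx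
    calc (1 : ℝ≥0∞) = c''⁻¹ * c'' := (ENNReal.inv_mul_cancel h0 htop).symm
      _ ≤ _ := by gcongr

theorem IsTruncation.upper_ne_zero [IsFiniteMeasure P₀] [IsProbabilityMeasure P₁]
    (h : IsTruncation P₀ P₁ p₀ p₁ ε c' c'') (hε : ε < 1) : c'' ≠ 0 := by
  rintro rfl
  have := h.upper
  simp [ENNReal.mul_top, hε] at this
  exact measure_ne_top P₀ _ this.symm

theorem ofReal_one_sub_lt_one (hε : 0 < ε) : ENNReal.ofReal (1 - ε) < 1 := by
  rw [ENNReal.ofReal_lt_one]; linarith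

/-- With `c'' = ∞` nothing is truncated, and the factor `1 - ε < 1` loses mass. -/
theorem IsTruncation.upper_ne_top [IsFiniteMeasure P₀] (hP₀ : P₀ ≠ 0)
    (hfin : ∀ᵐ x ∂P₀, p₁ x / p₀ x ≠ ∞)
    (h : IsTruncation P₀ P₁ p₀ p₁ ε c' c'') (hε : 0 < ε) : c'' ≠ ∞ := by
  rintro rfl
  have hu := h.upper
  have : P₀ {x | p₁ x / p₀ x < ∞} = P₀ Set.univ :=
    measure_congr (eventuallyEq_univ.2 (hfin.mono fun x hx => hx.lt_top))
  rw [this] at hu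
  simp only [ENNReal.inv_top, zero_mul, add_zero] at hu
  have h0 : P₀ Set.univ ≠ 0 := by simpa using hP₀
  have := ENNReal.mul_lt_mul_left h0 (measure_ne_top P₀ _) (ofReal_one_sub_lt_one hε)
  rw [one_mul, hu] at this
  exact lt_irrefl _ this

theorem IsTruncation.lower_ne_top (hP₀ : P₀ ≠ 0)
    (h : IsTruncation P₀ P₁ p₀ p₁ ε c' c'') (hε : ε < 1) : c' ≠ ∞ := by
  rintro rfl
  have := h.lower
  simp [ENNReal.top_mul, ENNReal.mul_top, hε, hP₀] at this

end Truncation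

theorem tendsto_ofReal_one_sub :
    Tendsto (fun ε : ℝ => ENNReal.ofReal (1 - ε)) (𝓝[>] 0) (𝓝 1) := by
  have : Tendsto (fun ε : ℝ => ENNReal.ofReal (1 - ε)) (𝓝 0) (𝓝 (ENNReal.ofReal (1 - 0))) :=
    (ENNReal.continuous_ofReal.comp (continuous_const.sub continuous_id)).tendsto 0
  simpa using this.mono_left nhdsWithin_le_nhds

theorem eventually_lt_ofReal_one_sub_mul {a b : ℝ≥0∞} (h : a < b) :
    ∀ᶠ ε in 𝓝[>] (0 : ℝ), a < ENNReal.ofReal (1 - ε) * b := by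
  have := ENNReal.Tendsto.mul_const (b := b) tendsto_ofReal_one_sub (Or.inl one_ne_zero)
  rw [one_mul] at this
  exact this.eventually_const_lt h

theorem eventually_pos_lt_one : ∀ᶠ ε in 𝓝[>] (0 : ℝ), 0 < ε ∧ ε < 1 :=
  Ioo_mem_nhdsGT one_pos

/-! ### Behaviour of the truncation levels as `ε` tends to zero. -/

section Limits

variable {P₀ P₁ : Measure 𝓧} {p₀ p₁ : 𝓧 → ℝ≥0∞} {c' c'' : ℝ → ℝ≥0∞}

/-- If `c'' ≤ y`, then `∫ max(1, Z/c'') ≥ ∫ max(1, Z/y)`, which exceeds `P₀(𝓧)` because `Z > y` has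
positive mass. For small `ε` this contradicts the upper equation. -/
theorem eventually_lt_upper [IsFiniteMeasure P₀] [IsProbabilityMeasure P₁] (hP₀ : P₀ ≠ 0)
    (hZ : Measurable fun x => p₁ x / p₀ x) (hP : P₁ = P₀.withDensity fun x => p₁ x / p₀ x)
    (hfin : ∀ᵐ x ∂P₀, p₁ x / p₀ x ≠ ∞)
    (h : ∀ᶠ ε in 𝓝[>] (0 : ℝ), IsTruncation P₀ P₁ p₀ p₁ ε (c' ε) (c'' ε))
    {y : ℝ≥0∞} (hy : y < essSup (fun x => p₁ x / p₀ x) P₀) :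
    ∀ᶠ ε in 𝓝[>] (0 : ℝ), y < c'' ε := by
  rcases eq_or_ne y 0 with rfl | hy0
  · filter_upwards [h, eventually_pos_lt_one] with ε hε hε1
    exact pos_iff_ne_zero.2 (hε.upper_ne_zero hε1.2)
  have hytop : y ≠ ∞ := hy.ne_top
  have key : P₀ Set.univ < ∫⁻ x, max 1 (y⁻¹ * (p₁ x / p₀ x)) ∂P₀ := by
    rw [← lintegral_one]
    refine lintegral_strict_mono_of_ae_le_of_ae_lt_on
      (measurable_const.max (hZ.const_mul _)).aemeasurable (by simp)
      (ae_of_all _ fun x => le_max_left _ _) (s := {x | y < p₁ x / p₀ x}) (fun h0 => ?_)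
      (ae_of_all _ fun x hx => ?_)
    · refine hy.not_ge (essSup_le_of_ae_le _ ?_)
      filter_upwards [measure_eq_zero_iff_ae_notMem.1 h0] with x hx
      simpa using hx
    · refine lt_max_of_lt_right ?_
      rw [mul_comm, ← div_eq_mul_inv, ENNReal.lt_div_iff_mul_lt (Or.inl hy0) (Or.inl hytop),
        one_mul]
      exact hx
  filter_upwards [h, eventually_pos_lt_one, eventually_lt_ofReal_one_sub_mul key]
    with ε hε hε1 hlt
  by_contra! hle
  rw [← hε.lintegral_max_upper hZ hP (hε.upper_ne_zero hε1.2)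
    (hε.upper_ne_top hP₀ hfin hε1.1)] at hlt
  refine hlt.not_ge ?_
  gcongr

theorem eventually_lower_lt [IsProbabilityMeasure P₁]
    (hZ : Measurable fun x => p₁ x / p₀ x) (hP : P₁ = P₀.withDensity fun x => p₁ x / p₀ x)
    (h : ∀ᶠ ε in 𝓝[>] (0 : ℝ), IsTruncation P₀ P₁ p₀ p₁ ε (c' ε) (c'' ε))
    {y : ℝ≥0∞} (hy : essInf (fun x => p₁ x / p₀ x) P₀ < y) :
    ∀ᶠ ε in 𝓝[>] (0 : ℝ), c' ε < y := by
  have hone : ∫⁻ x, p₁ x / p₀ x ∂P₀ = 1 := by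
    have := measure_univ (μ := P₁)
    rwa [hP, withDensity_apply _ MeasurableSet.univ, setLIntegral_univ] at this
  have key : 1 < ∫⁻ x, max (p₁ x / p₀ x) y ∂P₀ := by
    rw [← hone]
    refine lintegral_strict_mono_of_ae_le_of_ae_lt_on (hZ.max measurable_const).aemeasurable
      (by simp [hone]) (ae_of_all _ fun x => le_max_left _ _)
      (s := {x | p₁ x / p₀ x < y}) (fun h0 => ?_) (ae_of_all _ fun x hx => lt_max_of_lt_right hx)
    refine hy.not_ge (le_essInf_of_ae_le _ ?_)
    filter_upwards [measure_eq_zero_iff_ae_notMem.1 h0] with x hx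
    simpa using hx
  filter_upwards [h, eventually_lt_ofReal_one_sub_mul key] with ε hε hlt
  by_contra! hle
  rw [← hε.lintegral_max_lower hZ hP] at hlt
  refine hlt.not_ge ?_
  gcongr

/-- The levels need not converge; only their minimum or maximum with a value of `Z` matters. -/
theorem tendsto_min_of_eventually_lt {ι : Type*} {l : Filter ι} {f : ι → ℝ≥0∞} {z M : ℝ≥0∞}
    (hf : ∀ y < M, ∀ᶠ i in l, y < f i) (hz : z ≤ M) : Tendsto (fun i => min z (f i)) l (𝓝 z) := by
  refine tendsto_order.2 ⟨fun a ha => ?_, fun a ha => Eventually.of_forall fun i =>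
    (min_le_left _ _).trans_lt ha⟩
  filter_upwards [hf a (ha.trans_le hz)] with i hi using lt_min ha hi

theorem tendsto_max_of_eventually_lt {ι : Type*} {l : Filter ι} {f : ι → ℝ≥0∞} {z m : ℝ≥0∞}
    (hf : ∀ y > m, ∀ᶠ i in l, f i < y) (hz : m ≤ z) : Tendsto (fun i => max z (f i)) l (𝓝 z) := by
  refine tendsto_order.2 ⟨fun a ha => Eventually.of_forall fun i =>
    ha.trans_le (le_max_left _ _), fun a ha => ?_⟩
  filter_upwards [hf a (hz.trans_lt ha)] with i hi using max_lt ha hi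

/-- Multiplying the upper equation by `c''` and rearranging gives `c'' ε P₀(𝓧) = (1 - ε) ∫ (Z -
c'')⁺ dP₀`. -/
theorem upper_mul_le_lintegral_sub {ε : ℝ} {c' c'' : ℝ≥0∞} [IsFiniteMeasure P₀]
    (hZ : Measurable fun x => p₁ x / p₀ x) (hP : P₁ = P₀.withDensity fun x => p₁ x / p₀ x)
    (h : IsTruncation P₀ P₁ p₀ p₁ ε c' c'') (h0 : c'' ≠ 0) (htop : c'' ≠ ∞)
    (hε : 0 < ε) (hε1 : ε < 1) :
    c'' * ENNReal.ofReal ε * P₀ Set.univ ≤ ∫⁻ x, (p₁ x / p₀ x - c'') ∂P₀ := by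
  set a := ENNReal.ofReal (1 - ε)
  have ha : a + ENNReal.ofReal ε = 1 := by
    rw [← ENNReal.ofReal_add (by linarith) hε.le]; simp
  have hmax : c'' * ∫⁻ x, max 1 (c''⁻¹ * (p₁ x / p₀ x)) ∂P₀
      = c'' * P₀ Set.univ + ∫⁻ x, (p₁ x / p₀ x - c'') ∂P₀ := by
    rw [← lintegral_const_mul _ (measurable_const.max (hZ.const_mul _)), ← lintegral_const,
      ← lintegral_add_left measurable_const]
    refine lintegral_congr fun x => ?_
    rw [add_tsub_eq_max, mul_max, mul_one, ← mul_assoc, ENNReal.mul_inv_cancel h0 htop, one_mul]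
  have hk := h.lintegral_max_upper hZ hP h0 htop
  have hfin : c'' * a * P₀ Set.univ ≠ ∞ :=
    ENNReal.mul_ne_top (ENNReal.mul_ne_top htop ENNReal.ofReal_ne_top) (measure_ne_top _ _)
  have hsum : c'' * a * P₀ Set.univ + c'' * ENNReal.ofReal ε * P₀ Set.univ
      = c'' * a * P₀ Set.univ + a * ∫⁻ x, (p₁ x / p₀ x - c'') ∂P₀ := by
    calc _ = c'' * ((a + ENNReal.ofReal ε) * P₀ Set.univ) := by ring
      _ = a * (c'' * ∫⁻ x, max 1 (c''⁻¹ * (p₁ x / p₀ x)) ∂P₀) := by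
        rw [ha, one_mul, ← hk]; ring
      _ = _ := by rw [hmax]; ring
  rw [(ENNReal.add_right_inj hfin).1 hsum]
  exact mul_le_of_le_one_left' (ofReal_one_sub_lt_one hε).le

/-- `c''` itself may diverge, but the tail integral `∫ (Z - c'')⁺ dP₀` vanishes by dominated
convergence, `Z` being `P₀`-integrable. -/
theorem tendsto_upper_mul [IsFiniteMeasure P₀] [IsProbabilityMeasure P₁] (hP₀ : P₀ ≠ 0)
    (hZ : Measurable fun x => p₁ x / p₀ x) (hP : P₁ = P₀.withDensity fun x => p₁ x / p₀ x)
    (hfin : ∀ᵐ x ∂P₀, p₁ x / p₀ x ≠ ∞)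
    (h : ∀ᶠ ε in 𝓝[>] (0 : ℝ), IsTruncation P₀ P₁ p₀ p₁ ε (c' ε) (c'' ε)) :
    Tendsto (fun ε : ℝ => c'' ε * ENNReal.ofReal ε) (𝓝[>] 0) (𝓝 0) := by
  have hone : ∫⁻ x, p₁ x / p₀ x ∂P₀ = 1 := by
    have := measure_univ (μ := P₁)
    rwa [hP, withDensity_apply _ MeasurableSet.univ, setLIntegral_univ] at this
  have hint : Tendsto (fun ε : ℝ => ∫⁻ x, (p₁ x / p₀ x - c'' ε) ∂P₀) (𝓝[>] 0) (𝓝 0) := by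
    rw [← lintegral_zero (μ := P₀)]
    refine tendsto_lintegral_filter_of_dominated_convergence (fun x => p₁ x / p₀ x)
      (Eventually.of_forall fun ε => hZ.sub measurable_const)
      (Eventually.of_forall fun ε => ae_of_all _ fun x => tsub_le_self) (by simp [hone]) ?_
    filter_upwards [hfin, ENNReal.ae_le_essSup (μ := P₀) fun x => p₁ x / p₀ x] with x hx hM
    have hmin := tendsto_min_of_eventually_lt
      (fun y hy => eventually_lt_upper hP₀ hZ hP hfin h (y := y) hy) hM
    have := ENNReal.Tendsto.sub (tendsto_const_nhds (x := p₁ x / p₀ x)) hmin (Or.inl hx)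
    rw [tsub_self] at this
    refine this.congr fun ε => ?_
    rcases le_total (p₁ x / p₀ x) (c'' ε) with hle | hle <;> simp [hle, tsub_eq_zero_of_le]
  have h0 : P₀ Set.univ ≠ 0 := by simpa using hP₀
  have hdiv := ENNReal.Tendsto.div_const hint (Or.inr h0)
  rw [ENNReal.zero_div] at hdiv
  refine tendsto_of_tendsto_of_tendsto_of_le_of_le' tendsto_const_nhds hdiv
    (Eventually.of_forall fun _ => zero_le) ?_
  filter_upwards [h, eventually_pos_lt_one] with ε hε hε1
  rw [ENNReal.le_div_iff_mul_le (Or.inl h0) (Or.inl (measure_ne_top _ _))]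
  exact upper_mul_le_lintegral_sub hZ hP hε (hε.upper_ne_zero hε1.2)
    (hε.upper_ne_top hP₀ hfin hε1.1) hε1.1 hε1.2

end Limits

/-! ### Consequences of the numeraire property. -/

section Numeraire

variable {H₀ : Set (Measure 𝓧)} {P₁ μ : Measure 𝓧} {Bs p₀ p₁ : 𝓧 → ℝ≥0∞}

/-- Finite divergence supplies some `P` in the null with `P₁ ≪ P`, and `Bs` has finite
`P`-expectation. -/
theorem IsNumeraire.ae_ne_top (h_num : IsNumeraire H₀ P₁ Bs)
    (h_kl : (⨅ P ∈ H₀, InformationTheory.klDiv P₁ P) < ∞) : ∀ᵐ x ∂P₁, Bs x ≠ ∞ := by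
  obtain ⟨P, hP⟩ := iInf_lt_iff.1 h_kl
  obtain ⟨hPH, hP⟩ := iInf_lt_iff.1 hP
  have hac : P₁ ≪ P := (InformationTheory.klDiv_ne_top_iff.1 hP.ne).1
  have : ∀ᵐ x ∂P, Bs x < ∞ := ae_lt_top h_num.isEVariable.1
    ((h_num.isEVariable.2 P hPH).trans_lt ENNReal.one_lt_top).ne
  exact hac.ae_le (this.mono fun x hx => hx.ne)

theorem IsNumeraire.ripr_univ_le_one (h_num : IsNumeraire H₀ P₁ Bs)
    (h_prob : ∀ P ∈ H₀, IsProbabilityMeasure P) : ripr P₁ Bs Set.univ ≤ 1 := by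
  have h := h_num.numeraire (fun _ => 1)
    ⟨measurable_const, fun P hP => by have := h_prob P hP; simp⟩
  rw [ripr, withDensity_apply _ MeasurableSet.univ, setLIntegral_univ]
  simpa using h

theorem ae_density_cases [IsProbabilityMeasure P₁] (h_num : IsNumeraire H₀ P₁ Bs)
    (h_prob : ∀ P ∈ H₀, IsProbabilityMeasure P)
    (h_kl : (⨅ P ∈ H₀, InformationTheory.klDiv P₁ P) < ∞)
    (hp₀_meas : Measurable p₀) (hp₁_meas : Measurable p₁)
    (hp₀ : ripr P₁ Bs = μ.withDensity p₀) (hp₁ : P₁ = μ.withDensity p₁) :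
    ∀ᵐ x ∂μ, (p₀ x = 0 ∧ p₁ x = 0) ∨
      (p₀ x ≠ 0 ∧ p₀ x ≠ ∞ ∧ p₁ x ≠ 0 ∧ p₁ x ≠ ∞ ∧ p₁ x / p₀ x = Bs x) := by
  have hBs : Measurable Bs := h_num.isEVariable.1
  have hone : ∫⁻ x, p₁ x ∂μ = 1 := by
    have := measure_univ (μ := P₁)
    rwa [hp₁, withDensity_apply _ MeasurableSet.univ, setLIntegral_univ] at this
  have hp₁fin : ∀ᵐ x ∂μ, p₁ x < ∞ := ae_lt_top hp₁_meas (by simp [hone])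
  have hp₀int : ∫⁻ x, p₀ x ∂μ ≠ ∞ := by
    have := h_num.ripr_univ_le_one h_prob
    rw [hp₀, withDensity_apply _ MeasurableSet.univ, setLIntegral_univ] at this
    exact (this.trans_lt ENNReal.one_lt_top).ne
  -- Uniqueness of densities; it needs the finite integral `hp₀int`.
  have heq : p₀ =ᵐ[μ] p₁ * fun x => (Bs x)⁻¹ := by
    refine (withDensity_eq_iff hp₀_meas.aemeasurable (hp₁_meas.mul hBs.inv).aemeasurable
      hp₀int).1 ?_
    rw [← hp₀, ripr]
    exact (hp₁ ▸ withDensity_mul μ hp₁_meas hBs.inv).symm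
  have hpos := h_num.pos
  have hfin := h_num.ae_ne_top h_kl
  rw [hp₁, ae_withDensity_iff hp₁_meas] at hpos hfin
  filter_upwards [heq, hpos, hfin, hp₁fin] with x hx hx0 hxt hx1
  simp only [Pi.mul_apply] at hx
  rcases eq_or_ne (p₁ x) 0 with h1 | h1
  · left; simp [hx, h1]
  · right
    have b0 := (hx0 h1).ne'
    have bt := hxt h1
    refine ⟨by simp [hx, h1, bt], ?_, h1, hx1.ne, ?_⟩
    · rw [hx]; exact ENNReal.mul_ne_top hx1.ne (by simpa using b0)
    · rw [hx, div_eq_mul_inv, ENNReal.mul_inv (Or.inl h1) (Or.inl hx1.ne), inv_inv, ← mul_assoc,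
        ENNReal.mul_inv_cancel h1 hx1.ne, one_mul]

/-- A numeraire that is finite under the alternative has supremal expectation one. -/
theorem IsNumeraire.one_le_iSup [IsProbabilityMeasure P₁] (h_num : IsNumeraire H₀ P₁ Bs)
    (hfin : ∀ᵐ x ∂P₁, Bs x ≠ ∞) : 1 ≤ ⨆ P ∈ H₀, ∫⁻ x, Bs x ∂P := by
  by_contra! hlt
  obtain ⟨s, hs, hs1⟩ := exists_between hlt
  have hs0 : s ≠ 0 := (zero_le.trans_lt hs).ne'
  have hst : s ≠ ∞ := hs1.ne_top
  -- Were the supremum below `s < 1`, this rescaling would still be an e-variable, with ratio `s⁻¹ >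
  -- 1` to `Bs`.
  have hE : IsEVariable H₀ (fun x => s⁻¹ * Bs x) := by
    refine ⟨h_num.isEVariable.1.const_mul _, fun P hP => ?_⟩
    rw [lintegral_const_mul _ h_num.isEVariable.1]
    calc s⁻¹ * ∫⁻ x, Bs x ∂P ≤ s⁻¹ * s := by
          gcongr; exact (le_iSup₂ (f := fun P _ => ∫⁻ x, Bs x ∂P) P hP).trans hs.le
      _ = 1 := ENNReal.inv_mul_cancel hs0 hst
  have hle := h_num.numeraire _ hE
  have : ∫⁻ x, s⁻¹ * Bs x / Bs x ∂P₁ = s⁻¹ := by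
    rw [lintegral_congr_ae (g := fun _ => s⁻¹)]
    · simp
    · filter_upwards [h_num.pos, hfin] with x h0 ht
      exact ENNReal.mul_div_cancel_right h0.ne' ht
  rw [this] at hle
  exact (ENNReal.one_lt_inv.2 hs1).not_ge hle

end Numeraire

/-! ### The normalising denominator. -/

section RobustB

variable {H₀ : Set (Measure 𝓧)} {μ : Measure 𝓧} {p₀ p₁ : 𝓧 → ℝ≥0∞} {c' c'' : ℝ → ℝ≥0∞}

/-- From below, a single nearly optimal `P` and dominated convergence suffice. From above, the
additive error `c' - m` does not depend on `x`, so it bounds all expectations uniformly in `P`. -/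
theorem tendsto_robustB_denominator
    (h_prob : ∀ P ∈ H₀, IsProbabilityMeasure P) (h_dom : ∀ P ∈ H₀, P ≪ μ)
    (hZ : Measurable fun x => p₁ x / p₀ x)
    (hE : IsEVariable H₀ fun x => p₁ x / p₀ x)
    (hsup : 1 ≤ ⨆ P ∈ H₀, ∫⁻ x, p₁ x / p₀ x ∂P)
    {m : ℝ≥0∞} (hm : m ≠ ∞)
    (hc'' : ∀ᵐ x ∂μ, Tendsto (fun ε => min (p₁ x / p₀ x) (c'' ε)) (𝓝[>] 0) (𝓝 (p₁ x / p₀ x)))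
    (hc' : ∀ y > m, ∀ᶠ ε in 𝓝[>] (0 : ℝ), c' ε < y)
    (hlow : ∀ᶠ ε in 𝓝[>] (0 : ℝ), ∀ᵐ x ∂μ,
      min (p₁ x / p₀ x) (c'' ε) ≤ truncRatio p₀ p₁ ε (c' ε) (c'' ε) x)
    (hupp : ∀ᶠ ε in 𝓝[>] (0 : ℝ), ∀ᵐ x ∂μ,
      truncRatio p₀ p₁ ε (c' ε) (c'' ε) x ≤ p₁ x / p₀ x + (c' ε - m))
    (hmul : Tendsto (fun ε : ℝ => c'' ε * ENNReal.ofReal ε) (𝓝[>] 0) (𝓝 0)) :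
    Tendsto (fun ε : ℝ => (⨆ P ∈ H₀, ∫⁻ y, truncRatio p₀ p₁ ε (c' ε) (c'' ε) y ∂P)
      + (c'' ε - c' ε) * ENNReal.ofReal ε) (𝓝[>] 0) (𝓝 1) := by
  have hsub : Tendsto (fun ε => c' ε - m) (𝓝[>] 0) (𝓝 0) := by
    have hmax := tendsto_max_of_eventually_lt hc' le_rfl
    have := ENNReal.Tendsto.sub hmax (tendsto_const_nhds (x := m)) (Or.inl hm)
    rw [tsub_self] at this
    refine this.congr fun ε => ?_
    rcases le_total m (c' ε) with hle | hle <;> simp [hle, tsub_eq_zero_of_le]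
  refine tendsto_order.2 ⟨fun d hd => ?_, fun d hd => ?_⟩
  · obtain ⟨P, hP⟩ := lt_iSup_iff.1 (hd.trans_le hsup)
    obtain ⟨hPH, hP⟩ := lt_iSup_iff.1 hP
    have hlim : Tendsto (fun ε => ∫⁻ x, min (p₁ x / p₀ x) (c'' ε) ∂P) (𝓝[>] 0)
        (𝓝 (∫⁻ x, p₁ x / p₀ x ∂P)) :=
      tendsto_lintegral_filter_of_dominated_convergence (fun x => p₁ x / p₀ x)
        (Eventually.of_forall fun ε => hZ.min measurable_const)
        (Eventually.of_forall fun ε => ae_of_all _ fun x => min_le_left _ _)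
        ((hE.2 P hPH).trans_lt ENNReal.one_lt_top).ne ((h_dom P hPH).ae_le hc'')
    filter_upwards [hlim.eventually_const_lt hP, hlow] with ε hε hl
    calc d < ∫⁻ x, min (p₁ x / p₀ x) (c'' ε) ∂P := hε
      _ ≤ ∫⁻ x, truncRatio p₀ p₁ ε (c' ε) (c'' ε) x ∂P := lintegral_mono_ae ((h_dom P hPH).ae_le hl)
      _ ≤ ⨆ P ∈ H₀, ∫⁻ y, truncRatio p₀ p₁ ε (c' ε) (c'' ε) y ∂P :=
        le_iSup₂ (f := fun P _ => ∫⁻ y, truncRatio p₀ p₁ ε (c' ε) (c'' ε) y ∂P) P hPH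
      _ ≤ _ := le_self_add
  · have hlim : Tendsto (fun ε : ℝ => 1 + (c' ε - m) + c'' ε * ENNReal.ofReal ε) (𝓝[>] 0)
        (𝓝 1) := by
      simpa using (tendsto_const_nhds (x := (1 : ℝ≥0∞))).add hsub |>.add hmul
    filter_upwards [hlim.eventually_lt_const hd, hupp] with ε hε hu
    refine lt_of_le_of_lt (add_le_add (iSup₂_le fun P hPH => ?_) ?_) hε
    · have := h_prob P hPH
      calc _ ≤ ∫⁻ x, (p₁ x / p₀ x + (c' ε - m)) ∂P := lintegral_mono_ae ((h_dom P hPH).ae_le hu)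
        _ = ∫⁻ x, p₁ x / p₀ x ∂P + (c' ε - m) := by
          rw [lintegral_add_left hZ]; simp
        _ ≤ _ := by gcongr; exact hE.2 P hPH
    · gcongr
      exact tsub_le_self

end RobustB

end RobustNumeraire

/-! ### Assembly of the limits. -/

open RobustNumeraire in
theorem mainTheorem8 {𝓧 : Type*} [MeasurableSpace 𝓧]
    -- the null, the alternative and the dominating measure
    (H₀ : Set (Measure 𝓧)) (P₁ μ : Measure 𝓧)
    (h_prob : ∀ P ∈ H₀, IsProbabilityMeasure P) [IsProbabilityMeasure P₁]
    (h_dom : ∀ P ∈ H₀, P ≪ μ)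
    (h_closed : IsTVClosed H₀) (h_convex : Convex ℝ≥0 H₀)
    (h_kl : (⨅ P ∈ H₀, InformationTheory.klDiv P₁ P) < ∞)
    -- the numeraire, and densities of the alternative and of its reverse information projection
    (Bs : 𝓧 → ℝ≥0∞) (h_num : IsNumeraire H₀ P₁ Bs)
    (p₀ p₁ : 𝓧 → ℝ≥0∞) (hp₀_meas : Measurable p₀) (hp₁_meas : Measurable p₁)
    (hp₀ : ripr P₁ Bs = μ.withDensity p₀) (hp₁ : P₁ = μ.withDensity p₁)
    -- the truncation levels, for all small contamination levels
    (c' c'' : ℝ → ℝ≥0∞)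
    (h_trunc : ∀ᶠ ε in 𝓝[>] (0 : ℝ), IsTruncation (ripr P₁ Bs) P₁ p₀ p₁ ε (c' ε) (c'' ε)) :
    -- the likelihood ratio is a version of the numeraire
    IsNumeraire H₀ P₁ (fun x => p₁ x / p₀ x) ∧
    (∀ᵐ x ∂P₁, p₁ x / p₀ x = Bs x) ∧
    -- convergence of the robust e-variable to it
    (∀ᵐ x ∂μ, Tendsto (fun ε : ℝ => robustB H₀ p₀ p₁ ε (c' ε) (c'' ε) x)
      (𝓝[>] 0) (𝓝 (p₁ x / p₀ x))) ∧
    -- convergence of the process at each fixed time, for data whose laws are dominated by `μ`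
    (∀ (Ω : Type*) [MeasurableSpace Ω] (ℙ : Measure Ω) (X : ℕ → Ω → 𝓧),
      (∀ i, Measurable (X i)) → (∀ i, ℙ.map (X i) ≪ μ) → ∀ n : ℕ, ∀ᵐ ω ∂ℙ,
        Tendsto (fun ε : ℝ => process (robustB H₀ p₀ p₁ ε (c' ε) (c'' ε)) (fun i => X i ω) n)
          (𝓝[>] 0) (𝓝 (∏ i ∈ Finset.Icc 1 n, p₁ (X i ω) / p₀ (X i ω)))) := by
  have hcases := ae_density_cases h_num h_prob h_kl hp₀_meas hp₁_meas hp₀ hp₁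
  have hZ : Measurable fun x => p₁ x / p₀ x := hp₁_meas.div hp₀_meas
  have hZP₁ : ∀ᵐ x ∂P₁, p₁ x / p₀ x = Bs x := by
    rw [hp₁, ae_withDensity_iff hp₁_meas]
    filter_upwards [hcases] with x hx h1
    rcases hx with hx | hx
    · exact absurd hx.2 h1
    · exact hx.2.2.2.2
  have hE : IsEVariable H₀ fun x => p₁ x / p₀ x := by
    -- `Z ≤ Bs` holds `μ`-a.e.: the two agree except where both densities vanish, and there `Z = 0`.
    refine ⟨hZ, fun P hP => le_trans (lintegral_mono_ae ?_) (h_num.isEVariable.2 P hP)⟩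
    filter_upwards [(h_dom P hP).ae_le hcases] with x hx
    rcases hx with hx | hx
    · simp [hx.2]
    · exact hx.2.2.2.2.le
  have hnumZ : IsNumeraire H₀ P₁ fun x => p₁ x / p₀ x := by
    refine ⟨hE, ?_, fun B hB => ?_⟩
    · filter_upwards [hZP₁, h_num.pos] with x hx hpos using hx ▸ hpos
    · rw [lintegral_congr_ae (g := fun x => B x / Bs x)]
      · exact h_num.numeraire B hB
      · filter_upwards [hZP₁] with x hx
        rw [hx]
  have hZfin : ∀ᵐ x ∂μ, p₁ x / p₀ x ≠ ∞ := by
    filter_upwards [hcases] with x hx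
    rcases hx with hx | hx
    · simp [hx.2]
    · exact ENNReal.div_ne_top hx.2.2.2.1 hx.1
  have hP₀μ : ripr P₁ Bs ≪ μ := hp₀ ▸ withDensity_absolutelyContinuous _ _
  have hP₁μ : P₁ ≪ μ := by
    nth_rw 1 [hp₁]
    exact withDensity_absolutelyContinuous _ _
  have hP : P₁ = (ripr P₁ Bs).withDensity fun x => p₁ x / p₀ x := by
    rw [hp₀, ← withDensity_mul _ hp₀_meas hZ]
    nth_rw 1 [hp₁]
    refine withDensity_congr_ae ?_
    filter_upwards [hcases] with x hx
    rcases hx with hx | hx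
    · simp [hx.1, hx.2]
    · exact (ENNReal.mul_div_cancel hx.1 hx.2.1).symm
  have : IsFiniteMeasure (ripr P₁ Bs) :=
    ⟨(h_num.ripr_univ_le_one h_prob).trans_lt ENNReal.one_lt_top⟩
  have hP₀ : ripr P₁ Bs ≠ 0 := fun h0 => by
    rw [h0, withDensity_zero_left] at hP
    exact IsProbabilityMeasure.ne_zero P₁ hP
  have hfin₀ : ∀ᵐ x ∂ripr P₁ Bs, p₁ x / p₀ x ≠ ∞ := hP₀μ.ae_le hZfin
  set M := essSup (fun x => p₁ x / p₀ x) (ripr P₁ Bs)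
  set m := essInf (fun x => p₁ x / p₀ x) (ripr P₁ Bs)
  have hc'' : ∀ y < M, ∀ᶠ ε in 𝓝[>] (0 : ℝ), y < c'' ε := fun y hy =>
    eventually_lt_upper hP₀ hZ hP hfin₀ h_trunc hy
  have hc' : ∀ y > m, ∀ᶠ ε in 𝓝[>] (0 : ℝ), c' ε < y := fun y hy =>
    eventually_lower_lt hZ hP h_trunc hy
  have hleM : ∀ᵐ x ∂ripr P₁ Bs, p₁ x / p₀ x ≤ M := ae_le_essSup
  have hgem : ∀ᵐ x ∂ripr P₁ Bs, m ≤ p₁ x / p₀ x := ae_essInf_le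
  have hmfin : m ≠ ∞ := by
    have : NeZero (ripr P₁ Bs) := ⟨hP₀⟩
    obtain ⟨x, hx, hx'⟩ := (hgem.and hfin₀).exists
    exact (hx.trans_lt hx'.lt_top).ne
  rw [hp₀, ae_withDensity_iff hp₀_meas] at hleM hgem
  have hmin : ∀ᵐ x ∂μ, Tendsto (fun ε => min (p₁ x / p₀ x) (c'' ε)) (𝓝[>] 0)
      (𝓝 (p₁ x / p₀ x)) := by
    filter_upwards [hcases, hleM] with x hx hxM
    rcases hx with hx | hx
    · simp [hx.2]
    · exact tendsto_min_of_eventually_lt hc'' (hxM hx.1)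
  -- The threshold for `ε` is independent of `x`, so the bounds serve both under integrals and in
  -- pointwise limits.
  have hlow : ∀ᶠ ε in 𝓝[>] (0 : ℝ), ∀ x, (p₀ x ≠ 0 ∧ p₀ x ≠ ∞ ∧ p₁ x ≠ 0 ∧ p₁ x ≠ ∞) →
      min (p₁ x / p₀ x) (c'' ε) ≤ truncRatio p₀ p₁ ε (c' ε) (c'' ε) x ∧
      truncRatio p₀ p₁ ε (c' ε) (c'' ε) x ≤ max (p₁ x / p₀ x) (c' ε) := by
    filter_upwards [h_trunc, eventually_pos_lt_one] with ε hε hε1 x ⟨h1, h2, h3, h4⟩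
    have hc0 := hε.upper_ne_zero hε1.2
    have hct := hε.upper_ne_top hP₀ hfin₀ hε1.1
    exact ⟨min_le_truncRatio h1 h2 h3 h4 hc0 hct hε1.2, truncRatio_le_max h1 h2 hc0 hct⟩
  have hden := tendsto_robustB_denominator h_prob h_dom hZ hE
    (hnumZ.one_le_iSup (hP₁μ.ae_le hZfin)) hmfin hmin hc'
    (by
      filter_upwards [hlow] with ε hε
      filter_upwards [hcases] with x hx
      rcases hx with hx | hx
      · simp [hx.2]
      · exact (hε x ⟨hx.1, hx.2.1, hx.2.2.1, hx.2.2.2.1⟩).1)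
    (by
      filter_upwards [hlow] with ε hε
      filter_upwards [hcases, hgem] with x hx hxm
      rcases hx with hx | hx
      · simp [truncRatio_eq_zero hx.1 hx.2]
      · refine (hε x ⟨hx.1, hx.2.1, hx.2.2.1, hx.2.2.2.1⟩).2.trans (max_le le_self_add ?_)
        calc c' ε ≤ m + (c' ε - m) := le_add_tsub
          _ ≤ _ := by gcongr; exact hxm hx.1)
    (tendsto_upper_mul hP₀ hZ hP hfin₀ h_trunc)
  have hlim : ∀ᵐ x ∂μ, Tendsto (fun ε : ℝ => robustB H₀ p₀ p₁ ε (c' ε) (c'' ε) x)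
      (𝓝[>] 0) (𝓝 (p₁ x / p₀ x)) := by
    filter_upwards [hcases, hmin, hgem] with x hx hxmin hxm
    have htr : Tendsto (fun ε : ℝ => truncRatio p₀ p₁ ε (c' ε) (c'' ε) x) (𝓝[>] 0)
        (𝓝 (p₁ x / p₀ x)) := by
      rcases hx with hx | hx
      · simp only [truncRatio_eq_zero hx.1 hx.2, hx.2, ENNReal.zero_div]
        exact tendsto_const_nhds
      · exact tendsto_of_tendsto_of_tendsto_of_le_of_le' hxmin
          (tendsto_max_of_eventually_lt hc' (hxm hx.1))
          (hlow.mono fun ε hε => (hε x ⟨hx.1, hx.2.1, hx.2.2.1, hx.2.2.2.1⟩).1)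
          (hlow.mono fun ε hε => (hε x ⟨hx.1, hx.2.1, hx.2.2.1, hx.2.2.2.1⟩).2)
    have := ENNReal.Tendsto.div htr (Or.inr one_ne_zero) hden (Or.inl ENNReal.one_ne_top)
    rwa [div_one] at this
  refine ⟨hnumZ, hZP₁, hlim, fun Ω _ ℙ X hX hac n => ?_⟩
  have hall : ∀ᵐ ω ∂ℙ, ∀ i, Tendsto (fun ε : ℝ => robustB H₀ p₀ p₁ ε (c' ε) (c'' ε) (X i ω))
      (𝓝[>] 0) (𝓝 (p₁ (X i ω) / p₀ (X i ω))) ∧ p₁ (X i ω) / p₀ (X i ω) ≠ ∞ :=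
    ae_all_iff.2 fun i => ae_of_ae_map (hX i).aemeasurable ((hac i).ae_le (hlim.and hZfin))
  filter_upwards [hall] with ω hω
  exact tendsto_process (Z := fun x => p₁ x / p₀ x) (fun i => (hω i).1) (fun i => (hω i).2) n
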